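/- **Setting.** Let $(\mu_{\pi,j})_{j\ge 1}$ and $(\mu_{r,j})_{j\ge 1}$ be positive, square-summable sequences (the Mercer eigenvalues of two reproducing kernels satisfying the Hilbert–Schmidt condition), and let $\mathcal H_\pi$ and $\mathcal H_r$ be the corresponding reproducing kernel Hilbert spaces in eigenfunction coordinates, i.e. the spaces of real sequences with $\sum_j \pi_j^2/\mu_{\pi,j}<\infty$, resp. $\sum_j r_j^2/\mu_{r,j}<\infty$, with inner products $\langle \pi,\pi'\rangle_\pi=\sum_j \pi_j\pi'_j/\mu_{\pi,j}$ and $\langle r,r'\rangle_r=\sum_j r_jr'_j/\mu_{r,j}$. Put $S_\pi=\mathrm{diag}(\mu_{\pi,j}^{-1})$ and $S_r=\mathrm{diag}(\mu_{r,j}^{-1})$. Let $M:\mathcal H_\pi\to\mathcal H_r$ be a compact linear operator, $F(\pi,r)=\langle r,M\pi\rangle_r$, and $\tilde M=S_r^{1/2}MS_\pi^{-1/2}:\ell^2(\mathbb N)\to\ell^2(\mathbb N)$. Let $\zeta_1\ge\zeta_2\ge\dots\ge 0$ be the eigenvalues of $\tilde M^*\tilde M$ with multiplicity (continued by zeros if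 there are only finitely many non-zero ones), with orthonormal eigenvectors $\phi_1,\phi_2,\dots$, and let $\pi_j=S_\pi^{-1/2}\phi_j$. The policy set $C_\pi$ is a subset of the unit ball of $\mathcal H_\pi$ satisfying, for a constant $c_\pi>0$, the regularity assumption: for every $j$ there is $\tilde\pi_j\in C_\pi$ with $\tilde\pi_j\tilde\pi_j^\top\succeq c_\pi\,\pi_j\pi_j^\top$. The true reward $r^*\in\mathcal H_r$ satisfies $\|r^*\|_r=1$, and $\pi^*\in\operatorname{argmax}_{\pi\in C_\pi}F(\pi,r^*)$. The excess risk of a policy $\pi$ is $\Delta(\pi;r^*)=F(\pi^*,r^*)-F(\pi,r^*)$. **Algorithm.** Given $1\le J\le n$, choose $\tilde\pi_1,\dots,\tilde\pi_J\in C_\pi$ with $\tilde\pi_j\tilde\pi_j^\top\succeq c_\pi\,\pi_j\pi_j^\top$ and form a list $q_1,\dots,q_n$ of $n$ queries from them in which each $\tilde\pi_j$ occurs $n/J$ times (if $J$ does not divide $n$: at least $\lfloor n/J\rfloor$ times). Observe $y_i=F(q_i,r^*)+\varepsilon_i$ with $\varepsilon_1,\dots,\varepsilon_n$ independent $\mathcal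 N(0,\tau^2)$. With a regularization parameter $\lambda_{\rm reg}>0$ let $\hat r$ minimize $\frac1n\sum_{i=1}^n(y_i-\langle r,Mq_i\rangle_r)^2+\lambda_{\rm reg}\|r\|_r^2$ over $r\in\mathcal H_r$, and output $\hat\pi_{\rm plug}\in\operatorname{argmax}_{\pi\in C_\pi}F(\pi,\hat r)$. **Theorem.** For all $c_\pi>0$ and $B$ there is a constant $c>0$, depending only on $c_\pi$ and $B$, such that in the above setting with $\|\tilde M\|_{\rm op}\le B$, for all $1\le J\le n$, all $\lambda_{\rm reg}>0$ and all $\tau$, the excess risk of $\hat\pi_{\rm plug}$ is integrable and $$\bigl(\mathbb E[\Delta(\hat\pi_{\rm plug};r^*)]\bigr)^2\le c\left(1+\frac{\tau^2}{n\lambda_{\rm reg}^2}\right)\max\left\{\sup_{j\le J}\frac{\lambda_{\rm reg}^2J^2\zeta_j}{\zeta_j^2+\lambda_{\rm reg}^2J^2},\ \sup_{j>J}\zeta_j\right\}.$$ -/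

import Mathlib

open MeasureTheory ProbabilityTheory
open scoped ENNReal InnerProductSpace

noncomputable section

namespace DoublyNonparametric

/-- The standard sequence space `ℓ²(ℕ)` of real square-summable sequences. -/
abbrev L2 : Type := lp (fun _ : ℕ => ℝ) 2

/-- The Mercer eigenvalues of a kernel with the Hilbert-Schmidt property: a positive
square-summable sequence. -/
structure Spectrum where
  /-- The eigenvalues. -/
  val : ℕ → ℝ
  pos : ∀ j, 0 < val j
  hilbertSchmidt : Summable fun j => val j ^ 2

variable (s : Spectrum)

/-- The reproducing kernel Hilbert space with Mercer eigenvalues `μ j`, in the coordinates given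
by the eigenfunctions: the coefficient sequences `κ` with `∑ j, κ j ^ 2 / μ j < ∞`.  They are
automatically square-summable, see `RKHSpace.memlp`. -/
def ellipsoid : Submodule ℝ (ℕ → ℝ) where
  carrier := {κ | Summable fun j => κ j ^ 2 / s.val j}
  zero_mem' := by simp
  add_mem' := by
    intro a b ha hb
    have h : Summable fun j => 2 * (a j ^ 2 / s.val j) + 2 * (b j ^ 2 / s.val j) :=
      (ha.mul_left 2).add (hb.mul_left 2)
    refine Summable.of_nonneg_of_le (fun j => div_nonneg (sq_nonneg _) (s.pos j).le) (fun j => ?_) h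
    have e : 2 * (a j ^ 2 / s.val j) + 2 * (b j ^ 2 / s.val j)
        = (2 * a j ^ 2 + 2 * b j ^ 2) / s.val j := by ring
    rw [e]
    refine div_le_div_of_nonneg_right ?_ (s.pos j).le
    simp only [Pi.add_apply]
    nlinarith [sq_nonneg (a j - b j)]
  smul_mem' := by
    intro c a ha
    have h : Summable fun j => c ^ 2 * (a j ^ 2 / s.val j) := ha.mul_left _
    refine h.congr fun j => ?_
    simp only [Pi.smul_apply, smul_eq_mul]
    ring

/-- The coefficient space as a type; it carries the inner product
`⟪a, b⟫ = ∑ j, a j * b j / μ j` (and not the one of `ℓ²`). -/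
def RKHSpace : Type := ellipsoid s

namespace RKHSpace

instance : AddCommGroup (RKHSpace s) := inferInstanceAs (AddCommGroup (ellipsoid s))
instance : Module ℝ (RKHSpace s) := inferInstanceAs (Module ℝ (ellipsoid s))

variable {s}

/-- The coefficient sequence of an element. -/
def coeff (a : RKHSpace s) : ℕ → ℝ := a.1

theorem ext_coeff {a b : RKHSpace s} (h : ∀ j, a.coeff j = b.coeff j) : a = b :=
  Subtype.ext (funext h)

@[simp] theorem coeff_add (a b : RKHSpace s) (j : ℕ) :
    (a + b).coeff j = a.coeff j + b.coeff j := rfl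

@[simp] theorem coeff_smul (c : ℝ) (a : RKHSpace s) (j : ℕ) :
    (c • a).coeff j = c * a.coeff j := rfl

theorem summable_coeff (a : RKHSpace s) : Summable fun j => a.coeff j ^ 2 / s.val j := a.2

theorem memlp (a : RKHSpace s) : Memℓp a.coeff 2 := by
  refine memℓp_gen ?_
  obtain ⟨C, hC⟩ := s.hilbertSchmidt.tendsto_atTop_zero.bddAbove_range
  have hC' : ∀ j, s.val j ^ 2 ≤ C := fun j => hC ⟨j, rfl⟩
  have h := a.summable_coeff.mul_left (C + 1)
  refine Summable.of_nonneg_of_le (fun j => by positivity) (fun j => ?_) h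
  have hp := s.pos j
  have h1 : s.val j ≤ C + 1 := by nlinarith [hC' j, sq_nonneg (s.val j - 1)]
  have e : ‖a.coeff j‖ ^ (2 : ℝ≥0∞).toReal = s.val j * (a.coeff j ^ 2 / s.val j) := by
    rw [mul_div_cancel₀ _ hp.ne']
    simp
  rw [e]
  exact mul_le_mul_of_nonneg_right h1 (div_nonneg (sq_nonneg _) hp.le)

/-- The map `S^{1/2}` with `S = diag (μ j)⁻¹`, as a linear bijection onto `ℓ²`. -/
def sqrtSLin : RKHSpace s ≃ₗ[ℝ] L2 where
  toFun a := ⟨fun j => a.coeff j / √(s.val j), by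
    refine memℓp_gen (a.summable_coeff.congr fun j => ?_)
    simp [div_pow, Real.sq_sqrt (s.pos j).le]⟩
  map_add' a b := by
    ext j
    exact add_div (a.coeff j) (b.coeff j) _
  map_smul' c a := by
    ext j
    exact mul_div_assoc c (a.coeff j) _
  invFun x := ⟨fun j => √(s.val j) * x j, by
    have h := (memℓp_gen_iff (p := 2) (by norm_num)).1 x.2
    refine h.congr fun j => ?_
    have hp := s.pos j
    rw [mul_pow, Real.sq_sqrt hp.le, mul_div_cancel_left₀ _ hp.ne']
    simp⟩
  left_inv a := by
    refine ext_coeff fun j => ?_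
    have hp := (Real.sqrt_pos.2 (s.pos j)).ne'
    exact mul_div_cancel₀ _ hp
  right_inv x := by
    ext j
    have hp := (Real.sqrt_pos.2 (s.pos j)).ne'
    exact mul_div_cancel_left₀ _ hp

theorem sqrtSLin_inner (a b : RKHSpace s) :
    ⟪sqrtSLin a, sqrtSLin b⟫_ℝ = ∑' j, a.coeff j * b.coeff j / s.val j := by
  rw [lp.inner_eq_tsum]
  refine tsum_congr fun j => ?_
  have hp := Real.mul_self_sqrt (s.pos j).le
  change b.coeff j / √(s.val j) * (a.coeff j / √(s.val j)) = _
  rw [div_mul_div_comm, hp, mul_comm]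

/-- The inner product of the reproducing kernel Hilbert space, in coordinates. -/
@[reducible] def core (s : Spectrum) : InnerProductSpace.Core ℝ (RKHSpace s) where
  inner a b := ∑' j, a.coeff j * b.coeff j / s.val j
  conj_inner_symm a b := by
    simp only [← sqrtSLin_inner]
    exact inner_conj_symm _ _
  re_inner_nonneg a := by
    simp only [← sqrtSLin_inner]
    exact inner_self_nonneg
  add_left a b c := by
    simp only [← sqrtSLin_inner, map_add]
    exact inner_add_left _ _ _
  smul_left a b c := by
    simp only [← sqrtSLin_inner, map_smul]
    exact inner_smul_left _ _ _
  definite a h := by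
    simp only [← sqrtSLin_inner] at h
    exact (LinearEquiv.map_eq_zero_iff _).1 (inner_self_eq_zero.1 h)

instance : NormedAddCommGroup (RKHSpace s) := (core s).toNormedAddCommGroup
instance : InnerProductSpace ℝ (RKHSpace s) := InnerProductSpace.ofCore (core s).toCore

theorem inner_def (a b : RKHSpace s) :
    ⟪a, b⟫_ℝ = ∑' j, a.coeff j * b.coeff j / s.val j := rfl

/-- `S^{1/2}`, as an isometric isomorphism of the reproducing kernel Hilbert space onto `ℓ²`;
its inverse is `S^{-1/2}`. -/
def sqrtS (s : Spectrum) : RKHSpace s ≃ₗᵢ[ℝ] L2 :=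
  LinearEquiv.isometryOfInner sqrtSLin fun a b => by rw [sqrtSLin_inner, inner_def]

theorem sqrtS_apply (a : RKHSpace s) (j : ℕ) :
    sqrtS s a j = a.coeff j / √(s.val j) := rfl

theorem sqrtS_symm_coeff (x : L2) (j : ℕ) :
    ((sqrtS s).symm x).coeff j = √(s.val j) * x j := rfl

end RKHSpace

open RKHSpace

variable {s} {p r : Spectrum}

/-- The reward `F(π, r) = ⟪r, M π⟫` of the policy `π` under the reward function `r`. -/
def reward (M : RKHSpace p →L[ℝ] RKHSpace r) (π : RKHSpace p) (ρ : RKHSpace r) : ℝ :=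
  ⟪ρ, M π⟫_ℝ

/-- `π` maximizes the reward under the reward function `ρ` over the policy set `C`. -/
def IsOptimalPolicy (M : RKHSpace p →L[ℝ] RKHSpace r) (C : Set (RKHSpace p)) (ρ : RKHSpace r)
    (π : RKHSpace p) : Prop :=
  π ∈ C ∧ ∀ π' ∈ C, reward M π' ρ ≤ reward M π ρ

/-- The operator `S_r^{1/2} M S_π^{-1/2}` on `ℓ²`. -/
def tildeMap (M : RKHSpace p →L[ℝ] RKHSpace r) : L2 →L[ℝ] L2 :=
  (sqrtS r).toContinuousLinearEquiv.toContinuousLinearMap ∘L M ∘L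
    (sqrtS p).symm.toContinuousLinearEquiv.toContinuousLinearMap

theorem tildeMap_apply (M : RKHSpace p →L[ℝ] RKHSpace r) (x : L2) :
    tildeMap M x = sqrtS r (M ((sqrtS p).symm x)) := rfl

/-- `φ` and `ζ` list the eigenfunctions and the eigenvalues of `T` in decreasing order and with
multiplicities: the `φ j` are orthonormal eigenfunctions, and `T` vanishes on the vectors
orthogonal to all of them.  (If `T` has finite rank, the list ends in zeros; if there are
infinitely many non-zero eigenvalues, the kernel of `T` may be left out.) -/
structure IsOrderedEigensystem (T : L2 →L[ℝ] L2) (φ : ℕ → L2) (ζ : ℕ → ℝ) : Prop where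
  orthonormal : Orthonormal ℝ φ
  eigen : ∀ j, T (φ j) = ζ j • φ j
  antitone : Antitone ζ
  complete : ∀ x : L2, (∀ j, ⟪φ j, x⟫_ℝ = 0) → T x = 0

/-- The infinite matrix `π πᵀ`. -/
def outer (π : RKHSpace p) : Matrix ℕ ℕ ℝ := Matrix.vecMulVec π.coeff π.coeff

/-- The policy `S_π^{-1/2} φ` belonging to an eigenfunction `φ`. -/
def direction (p : Spectrum) (φ : L2) : RKHSpace p := (sqrtS p).symm φ

/-- The policy `π'` is aligned with `π`: `π' π'ᵀ ⪰ c π πᵀ` in the Loewner order. -/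
def IsAligned (c : ℝ) (π' π : RKHSpace p) : Prop :=
  (outer π' - c • outer π).PosSemidef

/-- Regularity of the policy set `C` with constant `c`: it contains a policy aligned with each of
the directions belonging to the eigenfunctions `φ j`. -/
def IsRegular (C : Set (RKHSpace p)) (φ : ℕ → L2) (c : ℝ) : Prop :=
  ∀ j, ∃ π' ∈ C, IsAligned c π' (direction p (φ j))

/-- The `n` queries `Q` form a possible output of the passive querying strategy with exploration
parameter `J`: there are policies in `C` aligned with the top `J` directions, and the list `Q`
consists of them, each occurring at least `⌊n / J⌋` times (so exactly `n / J` times if `J`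
divides `n`). -/
def IsPassiveQueryList (C : Set (RKHSpace p)) (φ : ℕ → L2) (c : ℝ) (n J : ℕ)
    (Q : Fin n → RKHSpace p) : Prop :=
  ∃ (π' : Fin J → RKHSpace p) (a : Fin n → Fin J),
    (∀ j, π' j ∈ C ∧ IsAligned c (π' j) (direction p (φ j))) ∧
    (∀ j, n / J ≤ (Finset.univ.filter fun i => a i = j).card) ∧
    ∀ i, Q i = π' (a i)

/-- The ridge regression objective for the query-response pairs `(Q i, y i)`. -/
def ridgeObjective (M : RKHSpace p →L[ℝ] RKHSpace r) {n : ℕ} (Q : Fin n → RKHSpace p)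
    (y : Fin n → ℝ) (lam : ℝ) (ρ : RKHSpace r) : ℝ :=
  (1 / (n : ℝ)) * ∑ i, (y i - reward M (Q i) ρ) ^ 2 + lam * ‖ρ‖ ^ 2

/-- `ρ` is a ridge regression estimate: a minimizer of the ridge regression objective. -/
def IsRidgeEstimate (M : RKHSpace p →L[ℝ] RKHSpace r) {n : ℕ} (Q : Fin n → RKHSpace p)
    (y : Fin n → ℝ) (lam : ℝ) (ρ : RKHSpace r) : Prop :=
  ∀ ρ', ridgeObjective M Q y lam ρ ≤ ridgeObjective M Q y lam ρ'

/-- The oracle's response to the query `π`, with true reward `ρ` and noise `e`. -/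
def oracle (M : RKHSpace p →L[ℝ] RKHSpace r) (ρ : RKHSpace r) (π : RKHSpace p) (e : ℝ) : ℝ :=
  reward M π ρ + e

/-- The policy `π` is a possible output of policy learning via reward learning on the data
`(Q i, y i)`: it maximizes the reward predicted by a ridge regression estimate. -/
def IsPlugin (M : RKHSpace p →L[ℝ] RKHSpace r) (C : Set (RKHSpace p)) {n : ℕ}
    (Q : Fin n → RKHSpace p) (y : Fin n → ℝ) (lam : ℝ) (π : RKHSpace p) : Prop :=
  ∃ ρ, IsRidgeEstimate M Q y lam ρ ∧ IsOptimalPolicy M C ρ π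

/-- The excess risk of the policy `π` relative to the optimal policy `πs`. -/
def excessRisk (M : RKHSpace p →L[ℝ] RKHSpace r) (ρ : RKHSpace r) (πs π : RKHSpace p) : ℝ :=
  reward M πs ρ - reward M π ρ

end DoublyNonparametric

end

/-!
Both reproducing kernel Hilbert spaces are isometric to `ℓ²` through `S^{1/2}`, and the reward
becomes `⟪ρ, T π⟫` with `T = tildeMap M`.  Since all policies lie in the unit ball, the plugin
policy loses at most `2 ‖T* (ρ̂ - ρ*)‖` (`excessRisk_le`), and the square of the mean excess risk is
at most the mean of its square, so the mean of `‖T* (ρ̂ - ρ*)‖²` has to be bounded.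

A positive semidefinite domination between rank one matrices forces the vectors to be proportional
(`IsAligned.exists_eq_smul`), so the queries are multiples `β j • φ j` of the eigenfunctions, with
`cpol ≤ β j ^ 2 ≤ 1`.  As the `T (φ j)` are orthogonal with squared norms `ζ j`, the normal
equations of ridge regression (`IsRidgeEstimate.normal_equation`) decouple
(`IsOrderedEigensystem.ridge_coordinate_error`).  With `w j = N j * β j ^ 2 / n`, where `N j` is the
number of queries in direction `j`, the error `⟪ρ̂ - ρ*, T (φ j)⟫` consists of the bias
`-lam * ⟪ρ*, T (φ j)⟫ / (lam + w j * ζ j)` and of a noise term with variance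
`ζ j ^ 2 * w j * τ ^ 2 / (n * (lam + w j * ζ j) ^ 2)`.

* The coordinates `j ≥ J` of `ρ̂` vanish; the spectral tail bound
  (`IsOrderedEigensystem.norm_sq_map_le`) leaves `ζ J` there
  (`IsOrderedEigensystem.norm_sq_adjoint_sub_le`).
* The squared biases are summed by Bessel's inequality (`IsOrderedEigensystem.sum_mul_inner_sq_le`),
  and `w j ≥ cpol / (2 * J)` compares the squared bias factor with the rate (`bias_factor_le`).
* The variances are summed by means of `∑ j, w j ≤ 1`
  (`IsOrderedEigensystem.sum_variance_le`); this is where `ζ j ≤ ‖T‖ ^ 2 ≤ B ^ 2` enters.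
-/

namespace DoublyNonparametric

open RKHSpace

/-! ### Singular values of the operator -/

namespace IsOrderedEigensystem

variable {T : L2 →L[ℝ] L2} {φ : ℕ → L2} {ζ : ℕ → ℝ}

theorem inner_map_map (h : IsOrderedEigensystem (T.adjoint ∘L T) φ ζ) (j : ℕ) (x : L2) :
    ⟪T (φ j), T x⟫_ℝ = ζ j * ⟪φ j, x⟫_ℝ := by
  have e := h.eigen j
  rw [ContinuousLinearMap.comp_apply] at e
  rw [← ContinuousLinearMap.adjoint_inner_left, e, real_inner_smul_left]

theorem inner_map_map_eq_ite (h : IsOrderedEigensystem (T.adjoint ∘L T) φ ζ) (i j : ℕ) :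
    ⟪T (φ i), T (φ j)⟫_ℝ = if i = j then ζ i else 0 := by
  rw [h.inner_map_map, orthonormal_iff_ite.1 h.orthonormal]
  split_ifs <;> simp

theorem eq_norm_sq (h : IsOrderedEigensystem (T.adjoint ∘L T) φ ζ) (j : ℕ) :
    ζ j = ‖T (φ j)‖ ^ 2 := by
  rw [← real_inner_self_eq_norm_sq, h.inner_map_map_eq_ite, if_pos rfl]

theorem nonneg (h : IsOrderedEigensystem (T.adjoint ∘L T) φ ζ) (j : ℕ) : 0 ≤ ζ j := by
  rw [h.eq_norm_sq]; positivity

theorem le_opNorm_sq (h : IsOrderedEigensystem (T.adjoint ∘L T) φ ζ) (j : ℕ) :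
    ζ j ≤ ‖T‖ ^ 2 := by
  rw [h.eq_norm_sq]
  have := T.le_opNorm (φ j)
  rw [h.orthonormal.1 j, mul_one] at this
  gcongr

/-- The tail bound of the spectral theorem: `‖T u‖² ≤ ζ J ‖u‖²` for `u` orthogonal to the top `J`
eigenfunctions.  The part of `u` orthogonal to all the eigenfunctions is killed by `T` since the
eigensystem is complete. -/
theorem norm_sq_map_le (h : IsOrderedEigensystem (T.adjoint ∘L T) φ ζ) {J : ℕ} {u : L2}
    (hu : ∀ j < J, ⟪φ j, u⟫_ℝ = 0) : ‖T u‖ ^ 2 ≤ ζ J * ‖u‖ ^ 2 := by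
  have hb : Summable fun j => ⟪φ j, u⟫_ℝ ^ 2 := by
    simpa using h.orthonormal.inner_products_summable u
  have hbessel : ∑' j, ⟪φ j, u⟫_ℝ ^ 2 ≤ ‖u‖ ^ 2 := by
    simpa using h.orthonormal.tsum_inner_products_le u
  have hs : Summable fun j => ⟪φ j, u⟫_ℝ • φ j := by
    have := (h.orthonormal.orthogonalFamily.summable_iff_norm_sq_summable
      (fun j => ⟪φ j, u⟫_ℝ)).2 (by simpa using hb)
    simpa using this
  obtain ⟨v, hv⟩ := hs
  have hcoef : ∀ k, ⟪φ k, v⟫_ℝ = ⟪φ k, u⟫_ℝ := by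
    intro k
    have h1 := hv.mapL (innerSL ℝ (φ k))
    refine h1.unique ?_
    have h2 := hasSum_ite_eq k (⟪φ k, u⟫_ℝ)
    refine h2.congr_fun ?_
    intro j
    simp only [innerSL_apply_apply, real_inner_smul_right,
      orthonormal_iff_ite.1 h.orthonormal]
    by_cases hjk : j = k
    · simp [hjk]
    · simp [hjk, Ne.symm hjk]
  have hker : (T.adjoint ∘L T) u = (T.adjoint ∘L T) v := by
    rw [← sub_eq_zero, ← map_sub]
    exact h.complete _ fun j => by rw [inner_sub_right, hcoef, sub_self]
  have h1 : HasSum (fun j => ζ j * ⟪φ j, u⟫_ℝ ^ 2) (‖T u‖ ^ 2) := by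
    have h2 := (hv.mapL (T.adjoint ∘L T)).mapL (innerSL ℝ u)
    have e : innerSL ℝ u ((T.adjoint ∘L T) v) = ‖T u‖ ^ 2 := by
      rw [← hker, innerSL_apply_apply, ContinuousLinearMap.comp_apply,
        ContinuousLinearMap.adjoint_inner_right, real_inner_self_eq_norm_sq]
    rw [e] at h2
    refine h2.congr_fun fun j => ?_
    rw [map_smul, h.eigen, innerSL_apply_apply, real_inner_smul_right, real_inner_smul_right,
      real_inner_comm]
    ring
  have hle : ∀ j, ζ j * ⟪φ j, u⟫_ℝ ^ 2 ≤ ζ J * ⟪φ j, u⟫_ℝ ^ 2 := by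
    intro j
    rcases lt_or_ge j J with hj | hj
    · simp [hu j hj]
    · exact mul_le_mul_of_nonneg_right (h.antitone hj) (sq_nonneg _)
  calc ‖T u‖ ^ 2 = ∑' j, ζ j * ⟪φ j, u⟫_ℝ ^ 2 := h1.tsum_eq.symm
    _ ≤ ∑' j, ζ J * ⟪φ j, u⟫_ℝ ^ 2 := h1.summable.tsum_le_tsum hle (hb.mul_left _)
    _ = ζ J * ∑' j, ⟪φ j, u⟫_ℝ ^ 2 := tsum_mul_left
    _ ≤ ζ J * ‖u‖ ^ 2 := mul_le_mul_of_nonneg_left hbessel (h.nonneg J)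

/-- Truncation: if `ρ` lies in the span of the images of the top `J` eigenfunctions (expressed by
duality in `hρ`), then `T* (ρ - ρ')` is controlled by its top `J` coordinates, up to the eigenvalue
`ζ J`. -/
theorem norm_sq_adjoint_sub_le (h : IsOrderedEigensystem (T.adjoint ∘L T) φ ζ) {J : ℕ}
    {ρ ρ' : L2} (hρ : ∀ x, (∀ j : Fin J, ⟪T (φ j), x⟫_ℝ = 0) → ⟪ρ, x⟫_ℝ = 0)
    (hρ' : ‖ρ'‖ ≤ 1) :
    ‖T.adjoint (ρ - ρ')‖ ^ 2 ≤ ∑ j : Fin J, ⟪ρ - ρ', T (φ j)⟫_ℝ ^ 2 + ζ J := by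
  set d := ρ - ρ' with hd
  set v := T.adjoint d with hv
  have hφ : Orthonormal ℝ fun j : Fin J => φ j := h.orthonormal.comp _ Fin.val_injective
  have hin : ∀ x, ⟪v, x⟫_ℝ = ⟪d, T x⟫_ℝ := fun x => ContinuousLinearMap.adjoint_inner_left _ _ _
  set t : L2 := ∑ j : Fin J, ⟪d, T (φ j)⟫_ℝ • φ j with ht
  set u := v - t with hu
  have htφ : ∀ j : Fin J, ⟪φ j, t⟫_ℝ = ⟪d, T (φ j)⟫_ℝ := fun j => by
    rw [ht]; exact hφ.inner_right_fintype _ _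
  have huφ : ∀ j : Fin J, ⟪φ j, u⟫_ℝ = 0 := fun j => by
    rw [hu, inner_sub_right, htφ, real_inner_comm, hin, sub_self]
  have htx : ∀ x : L2, ⟪t, x⟫_ℝ = ∑ j : Fin J, ⟪d, T (φ j)⟫_ℝ * ⟪φ j, x⟫_ℝ := fun x => by
    simp only [ht, sum_inner, real_inner_smul_left]
  have htu : ⟪t, u⟫_ℝ = 0 := by simp [htx, huφ]
  have htt : ‖t‖ ^ 2 = ∑ j : Fin J, ⟪d, T (φ j)⟫_ℝ ^ 2 := by
    rw [← real_inner_self_eq_norm_sq, htx]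
    exact Finset.sum_congr rfl fun j _ => by rw [htφ, sq]
  have hvv : ‖v‖ ^ 2 = ‖t‖ ^ 2 + ‖u‖ ^ 2 := by
    have : v = t + u := by rw [hu]; abel
    rw [this, norm_add_sq_real, htu]; ring
  have huu : ‖u‖ ^ 2 ≤ ‖T u‖ := by
    have h1 : ‖u‖ ^ 2 = ⟪v, u⟫_ℝ := by
      rw [← real_inner_self_eq_norm_sq]
      nth_rewrite 1 [hu]
      rw [inner_sub_left, htu, sub_zero]
    have h2 : ⟪ρ, T u⟫_ℝ = 0 := hρ _ fun j => by rw [h.inner_map_map, huφ, mul_zero]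
    rw [h1, hin, hd, inner_sub_left, h2, zero_sub, ← inner_neg_left]
    refine (real_inner_le_norm _ _).trans ?_
    rw [norm_neg]
    exact mul_le_of_le_one_left (norm_nonneg _) hρ'
  have hTu := h.norm_sq_map_le (J := J) (u := u) fun j hj => huφ ⟨j, hj⟩
  have h0 := h.nonneg J
  have : ‖u‖ ^ 2 ≤ ζ J := by
    by_contra! hlt
    have hpos : 0 < ‖u‖ ^ 2 := h0.trans_lt hlt
    nlinarith [norm_nonneg (T u)]
  rw [hvv, htt]
  gcongr

/-- Bessel's inequality for the orthogonal system `T (φ j)`, whose members have squared norms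
`ζ j`; stated with weights in order to avoid dividing by `ζ j`. -/
theorem sum_mul_inner_sq_le (h : IsOrderedEigensystem (T.adjoint ∘L T) φ ζ) {J : ℕ} {ρ : L2}
    (hρ : ‖ρ‖ ≤ 1) {b : Fin J → ℝ} (hb : ∀ j, 0 ≤ b j) {s : ℝ} (hs0 : 0 ≤ s)
    (hs : ∀ j : Fin J, b j * ζ j ≤ s) : ∑ j : Fin J, b j * ⟪ρ, T (φ j)⟫_ℝ ^ 2 ≤ s := by
  set X := ∑ j : Fin J, b j * ⟪ρ, T (φ j)⟫_ℝ ^ 2 with hX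
  set w : L2 := ∑ j : Fin J, (b j * ⟪ρ, T (φ j)⟫_ℝ) • T (φ j) with hw
  have hX0 : 0 ≤ X := Finset.sum_nonneg fun j _ => mul_nonneg (hb j) (sq_nonneg _)
  have h1 : ⟪ρ, w⟫_ℝ = X := by
    simp only [hw, hX, inner_sum, real_inner_smul_right]
    exact Finset.sum_congr rfl fun j _ => by ring
  have h2 : ‖w‖ ^ 2 ≤ s * X := by
    rw [← real_inner_self_eq_norm_sq]
    simp only [hw, sum_inner, inner_sum, real_inner_smul_left, real_inner_smul_right,
      h.inner_map_map_eq_ite, Fin.val_inj, mul_ite, mul_zero, Finset.sum_ite_eq', Finset.mem_univ,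
      if_true]
    rw [hX, Finset.mul_sum]
    refine Finset.sum_le_sum fun j _ => ?_
    calc _ = b j * ζ j * (b j * ⟪ρ, T (φ j)⟫_ℝ ^ 2) := by ring
      _ ≤ _ := mul_le_mul_of_nonneg_right (hs j)
        (mul_nonneg (hb j) (sq_nonneg _))
  have h3 : X ≤ ‖w‖ := by
    rw [← h1]
    exact (real_inner_le_norm _ _).trans (mul_le_of_le_one_left (norm_nonneg _) hρ)
  by_contra! hlt
  nlinarith [hs0.trans_lt hlt]

end IsOrderedEigensystem

variable {p r : Spectrum}

/-! ### Aligned policies -/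

/-- A rank one matrix dominates another one only if the vectors are proportional: testing
`π' π'ᵀ ⪰ c π πᵀ` on `π'ₖ eₗ - π'ₗ eₖ` gives proportionality, and testing on `eₖ` gives the size of
the factor. -/
theorem IsAligned.exists_eq_smul {c : ℝ} (hc : 0 < c) {π' π : RKHSpace p} (h : IsAligned c π' π)
    (hπ : π ≠ 0) : ∃ β : ℝ, c ≤ β ^ 2 ∧ π' = β • π := by
  classical
  have hquad : ∀ (k l : ℕ) (s t : ℝ), c * (s * π.coeff k + t * π.coeff l) ^ 2 ≤
      (s * π'.coeff k + t * π'.coeff l) ^ 2 := by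
    intro k l s t
    have h1 := h.2 (Finsupp.single k s + Finsupp.single l t)
    have hadd : ∀ f : ℕ → ℝ → ℝ, (∀ i, f i 0 = 0) → (∀ i a b, f i (a + b) = f i a + f i b) →
        (Finsupp.single k s + Finsupp.single l t).sum f = f k s + f l t := by
      intro f h0 ha
      rw [Finsupp.sum_add_index' h0 ha, Finsupp.sum_single_index (h0 k),
        Finsupp.sum_single_index (h0 l)]
    rw [hadd] at h1
    · rw [hadd, hadd] at h1
      · simp only [outer, Matrix.sub_apply, Matrix.smul_apply, Matrix.vecMulVec_apply, star_trivial,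
          smul_eq_mul] at h1
        nlinarith [h1]
      all_goals intros; ring
    · intro i; simp
    · intro i a b
      rw [← Finsupp.sum_add]
      exact Finsupp.sum_congr fun j _ => by simp only [star_trivial]; ring
  obtain ⟨k, hk⟩ : ∃ k, π.coeff k ≠ 0 := by
    by_contra! hall
    exact hπ (ext_coeff hall)
  refine ⟨π'.coeff k / π.coeff k, ?_, ext_coeff fun l => ?_⟩
  · have h1 := hquad k k 1 0
    simp only [one_mul, zero_mul, add_zero] at h1
    rw [div_pow, le_div_iff₀ (by positivity)]
    exact h1
  · have h1 := hquad k l (π'.coeff l) (-π'.coeff k)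
    have h2 : (π'.coeff l * π.coeff k + -π'.coeff k * π.coeff l) ^ 2 ≤ 0 := by
      have e : π'.coeff l * π'.coeff k + -π'.coeff k * π'.coeff l = 0 := by ring
      rw [e] at h1
      nlinarith [sq_nonneg (π'.coeff l * π.coeff k + -π'.coeff k * π.coeff l)]
    have h3 := pow_eq_zero_iff (two_ne_zero) |>.1 (le_antisymm h2 (sq_nonneg _))
    rw [coeff_smul]
    field_simp
    linarith

/-! ### Rewards in `ℓ²` coordinates -/

theorem reward_eq_inner_tildeMap (M : RKHSpace p →L[ℝ] RKHSpace r) (π : RKHSpace p)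
    (ρ : RKHSpace r) : reward M π ρ = ⟪sqrtS r ρ, tildeMap M (sqrtS p π)⟫_ℝ := by
  rw [tildeMap_apply, LinearIsometryEquiv.symm_apply_apply, LinearIsometryEquiv.inner_map_map,
    reward]

theorem norm_direction (p : Spectrum) (x : L2) : ‖direction p x‖ = ‖x‖ :=
  LinearIsometryEquiv.norm_map _ _

theorem reward_smul_direction (M : RKHSpace p →L[ℝ] RKHSpace r) (β : ℝ) (x : L2)
    (ρ : RKHSpace r) :
    reward M (β • direction p x) ρ = β * ⟪sqrtS r ρ, tildeMap M x⟫_ℝ := by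
  rw [reward_eq_inner_tildeMap, map_smul, map_smul, real_inner_smul_right, direction,
    LinearIsometryEquiv.apply_symm_apply]

/-- The excess risk of the maximizer of a perturbed linear functional: both rewards move by at most
`‖T* (ρ' - ρ)‖`, as the policies lie in the unit ball. -/
theorem excessRisk_le (M : RKHSpace p →L[ℝ] RKHSpace r) {C : Set (RKHSpace p)}
    (hC : C ⊆ Metric.closedBall 0 1) {ρ ρ' : RKHSpace r} {π π' : RKHSpace p} (hπ : π ∈ C)
    (hπ' : IsOptimalPolicy M C ρ' π') :
    excessRisk M ρ π π' ≤ 2 * ‖(tildeMap M).adjoint (sqrtS r ρ' - sqrtS r ρ)‖ := by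
  have hnorm : ∀ x ∈ C, ‖sqrtS p x‖ ≤ 1 := fun x hx => by
    rw [LinearIsometryEquiv.norm_map]; exact mem_closedBall_zero_iff.1 (hC hx)
  have hdiff : ∀ x ∈ C, |reward M x ρ' - reward M x ρ| ≤
      ‖(tildeMap M).adjoint (sqrtS r ρ' - sqrtS r ρ)‖ := by
    intro x hx
    rw [reward_eq_inner_tildeMap, reward_eq_inner_tildeMap, ← inner_sub_left,
      ← ContinuousLinearMap.adjoint_inner_left]
    exact (abs_real_inner_le_norm _ _).trans (mul_le_of_le_one_right (norm_nonneg _) (hnorm x hx))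
  have h1 := abs_le.1 (hdiff π hπ)
  have h2 := abs_le.1 (hdiff π' hπ'.1)
  have h3 := hπ'.2 π hπ
  rw [excessRisk]
  linarith [h1.1, h2.2]

/-! ### Ridge regression -/

/-- The normal equations of ridge regression, tested against `x`. -/
theorem IsRidgeEstimate.normal_equation {M : RKHSpace p →L[ℝ] RKHSpace r} {n : ℕ}
    {Q : Fin n → RKHSpace p} {y : Fin n → ℝ} {lam : ℝ} {ρ : RKHSpace r}
    (h : IsRidgeEstimate M Q y lam ρ) (x : RKHSpace r) :
    lam * ⟪ρ, x⟫_ℝ = 1 / (n : ℝ) * ∑ i, (y i - reward M (Q i) ρ) * reward M (Q i) x := by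
  set A := 1 / (n : ℝ) * ∑ i, (y i - reward M (Q i) ρ) * reward M (Q i) x with hA
  set D := 1 / (n : ℝ) * ∑ i, reward M (Q i) x ^ 2 + lam * ‖x‖ ^ 2 with hD
  have hexp : ∀ t : ℝ, 0 ≤ 2 * t * (lam * ⟪ρ, x⟫_ℝ - A) + t ^ 2 * D := by
    intro t
    have h1 := h (ρ + t • x)
    have e : ridgeObjective M Q y lam (ρ + t • x) - ridgeObjective M Q y lam ρ =
        2 * t * (lam * ⟪ρ, x⟫_ℝ - A) + t ^ 2 * D := by
      have hr : ∀ i, (y i - reward M (Q i) (ρ + t • x)) ^ 2 = (y i - reward M (Q i) ρ) ^ 2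
          - 2 * t * ((y i - reward M (Q i) ρ) * reward M (Q i) x)
          + t ^ 2 * reward M (Q i) x ^ 2 := by
        intro i
        simp only [reward, inner_add_left, real_inner_smul_left]
        ring
      simp only [ridgeObjective, hr, Finset.sum_add_distrib, Finset.sum_sub_distrib,
        ← Finset.mul_sum, norm_add_sq_real, norm_smul, real_inner_smul_right, hA, hD, mul_pow,
        Real.norm_eq_abs, sq_abs]
      ring
    linarith
  by_contra hne
  set L := lam * ⟪ρ, x⟫_ℝ - A with hL
  have hL0 : L ≠ 0 := sub_ne_zero.2 hne
  -- the quadratic polynomial is negative at a small multiple of `-L`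
  have h1 := hexp (-L / (|D| + 1))
  have hp : 0 < |D| + 1 := by positivity
  have e : 2 * (-L / (|D| + 1)) * L + (-L / (|D| + 1)) ^ 2 * D
      = L ^ 2 / (|D| + 1) ^ 2 * (D - 2 * (|D| + 1)) := by
    field_simp
    ring
  rw [e] at h1
  have h2 : 0 < L ^ 2 / (|D| + 1) ^ 2 := by positivity
  nlinarith [le_abs_self D, abs_nonneg D]

/-- In the eigenbasis ridge regression decouples: the error in coordinate `j` is the sum of a
shrinkage bias and of the noise `∑ e i` of the queries in that coordinate. -/
theorem IsOrderedEigensystem.ridge_coordinate_error {T : L2 →L[ℝ] L2} {φ : ℕ → L2} {ζ : ℕ → ℝ}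
    (h : IsOrderedEigensystem (T.adjoint ∘L T) φ ζ) {n J : ℕ} {a : Fin n → Fin J}
    {β : Fin J → ℝ} {e : Fin n → ℝ} {lam : ℝ} {ρ ρ' : L2}
    (hn : ∀ x, lam * ⟪ρ, x⟫_ℝ = 1 / (n : ℝ) * ∑ i,
      (β (a i) * ⟪ρ' - ρ, T (φ (a i))⟫_ℝ + e i) * (β (a i) * ⟪x, T (φ (a i))⟫_ℝ))
    (j : Fin J) :
    (lam + (Finset.univ.filter fun i => a i = j).card * β j ^ 2 / n * ζ j) *
        ⟪ρ - ρ', T (φ j)⟫_ℝ =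
      -lam * ⟪ρ', T (φ j)⟫_ℝ + ζ j * β j / n * ∑ i with a i = j, e i := by
  have h1 := hn (T (φ j))
  have h2 : ∑ i, (β (a i) * ⟪ρ' - ρ, T (φ (a i))⟫_ℝ + e i) *
      (β (a i) * ⟪T (φ j), T (φ (a i))⟫_ℝ) =
      ∑ i with a i = j, (β j * ⟪ρ' - ρ, T (φ j)⟫_ℝ + e i) * (β j * ζ j) := by
    rw [Finset.sum_filter]
    refine Finset.sum_congr rfl fun i _ => ?_
    rw [h.inner_map_map_eq_ite]
    by_cases hij : a i = j
    · simp [hij]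
    · have : (j : ℕ) ≠ a i := fun hh => hij (Fin.ext hh.symm)
      simp [hij, this]
  rw [h2, ← Finset.sum_mul, Finset.sum_add_distrib, Finset.sum_const, nsmul_eq_mul,
    ← neg_sub ρ ρ', inner_neg_left] at h1
  have h3 : ⟪ρ, T (φ j)⟫_ℝ = ⟪ρ - ρ', T (φ j)⟫_ℝ + ⟪ρ', T (φ j)⟫_ℝ := by
    rw [← inner_add_left, sub_add_cancel]
  rw [h3] at h1
  linear_combination h1

/-! ### Second moments of the noise -/

theorem integrable_and_integral_sq_sum_gaussian {Ω ι : Type*} [MeasurableSpace Ω] {P : Measure Ω}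
    [IsProbabilityMeasure P] {X : ι → Ω → ℝ} {v : NNReal} (hind : iIndepFun X P)
    (hX : ∀ i, HasLaw (X i) (gaussianReal 0 v) P) (s : Finset ι) :
    Integrable (fun ω => (∑ i ∈ s, X i ω) ^ 2) P ∧
      ∫ ω, (∑ i ∈ s, X i ω) ^ 2 ∂P = s.card * v := by
  have hL : ∀ i, MemLp (X i) 2 P := fun i => by
    have h1 : MemLp id 2 (P.map (X i)) := by
      rw [(hX i).map_eq]; exact memLp_id_gaussianReal' 2 (by simp)
    exact (memLp_map_measure_iff h1.aestronglyMeasurable (hX i).aemeasurable).1 h1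
  have hE : ∀ i, ∫ ω, X i ω ∂P = 0 := fun i => by
    rw [(hX i).integral_eq, integral_id_gaussianReal]
  have hV : ∀ i, variance (X i) P = v := fun i => by
    rw [(hX i).variance_eq, variance_id_gaussianReal]
  have hS : MemLp (∑ i ∈ s, X i) 2 P := memLp_finsetSum' s fun i _ => hL i
  have hSE : ∫ ω, (∑ i ∈ s, X i) ω ∂P = 0 := by
    simp only [Finset.sum_apply]
    rw [integral_finsetSum s fun i _ => (hL i).integrable one_le_two]
    simp [hE]
  refine ⟨by simpa using hS.integrable_sq, ?_⟩
  have h1 := IndepFun.variance_sum (s := s) (fun i _ => hL i)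
    (fun i _ j _ hij => hind.indepFun hij)
  rw [variance_of_integral_eq_zero hS.aemeasurable hSE] at h1
  simpa [hV] using h1

/-! ### The error bound -/

/-- A weight of at least `κ / (2 J)` on a coordinate with eigenvalue `z` makes the squared bias
factor comparable to the rate. -/
theorem bias_factor_le {κ lam J z w : ℝ} (hκ : 0 < κ) (hκ1 : κ ≤ 1) (hlam : 0 < lam) (hJ : 0 < J)
    (hz : 0 ≤ z) (hw : κ / (2 * J) ≤ w) :
    lam ^ 2 / (lam + w * z) ^ 2 * z ≤
      4 / κ ^ 2 * (lam ^ 2 * J ^ 2 * z / (z ^ 2 + lam ^ 2 * J ^ 2)) := by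
  have h1 : κ / (2 * J) * (lam * J + z) ≤ lam + w * z := by
    have e : κ / (2 * J) * (lam * J + z) = κ / 2 * lam + κ / (2 * J) * z := by
      field_simp
    rw [e]
    have := mul_le_mul_of_nonneg_right hw hz
    nlinarith
  have h2 : κ ^ 2 / (4 * J ^ 2) * (z ^ 2 + lam ^ 2 * J ^ 2) ≤ (lam + w * z) ^ 2 := by
    have h3 : 0 ≤ κ / (2 * J) * (lam * J + z) := by positivity
    calc _ ≤ (κ / (2 * J) * (lam * J + z)) ^ 2 := by
          have e : (κ / (2 * J) * (lam * J + z)) ^ 2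
              = κ ^ 2 / (4 * J ^ 2) * (lam * J + z) ^ 2 := by ring
          rw [e]
          have : 0 ≤ lam * J * z := by positivity
          gcongr
          nlinarith
      _ ≤ _ := by gcongr
  calc lam ^ 2 / (lam + w * z) ^ 2 * z
      ≤ lam ^ 2 / (κ ^ 2 / (4 * J ^ 2) * (z ^ 2 + lam ^ 2 * J ^ 2)) * z := by gcongr
    _ = _ := by
      have : z ^ 2 + lam ^ 2 * J ^ 2 ≠ 0 := by positivity
      field_simp

/-- The pathwise error bound: truncation at `J`, and squared bias plus squared noise in each of
the top `J` coordinates. -/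
theorem IsOrderedEigensystem.norm_sq_ridge_error_le {T : L2 →L[ℝ] L2} {φ : ℕ → L2} {ζ : ℕ → ℝ}
    (h : IsOrderedEigensystem (T.adjoint ∘L T) φ ζ) {n J : ℕ} {a : Fin n → Fin J}
    {β : Fin J → ℝ} {e : Fin n → ℝ} {lam : ℝ} (hlam : 0 < lam) {ρ ρ' : L2} (hρ' : ‖ρ'‖ ≤ 1)
    (hn : ∀ x, lam * ⟪ρ, x⟫_ℝ = 1 / (n : ℝ) * ∑ i,
      (β (a i) * ⟪ρ' - ρ, T (φ (a i))⟫_ℝ + e i) * (β (a i) * ⟪x, T (φ (a i))⟫_ℝ))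
    {w : Fin J → ℝ} (hw : ∀ j, w j = (Finset.univ.filter fun i => a i = j).card * β j ^ 2 / n)
    {s : ℝ} (hs0 : 0 ≤ s) (hs : ∀ j : Fin J, lam ^ 2 / (lam + w j * ζ j) ^ 2 * ζ j ≤ s) :
    ‖T.adjoint (ρ - ρ')‖ ^ 2 ≤
      2 * s + 2 * ∑ j : Fin J, (ζ j * β j / n / (lam + w j * ζ j)) ^ 2 * (∑ i with a i = j, e i) ^ 2
        + ζ J := by
  have hD : ∀ j : Fin J, 0 < lam + w j * ζ j := fun j => by
    have := h.nonneg j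
    rw [hw]
    positivity
  have hspan : ∀ x, (∀ j : Fin J, ⟪T (φ j), x⟫_ℝ = 0) → ⟪ρ, x⟫_ℝ = 0 := by
    intro x hx
    have h1 := hn x
    simp only [real_inner_comm (T _) x, hx, mul_zero, Finset.sum_const_zero] at h1
    exact (mul_eq_zero.1 h1).resolve_left hlam.ne'
  have hcoord : ∀ j : Fin J, ⟪ρ - ρ', T (φ j)⟫_ℝ ^ 2 ≤
      2 * (lam ^ 2 / (lam + w j * ζ j) ^ 2 * ⟪ρ', T (φ j)⟫_ℝ ^ 2) +
      2 * ((ζ j * β j / n / (lam + w j * ζ j)) ^ 2 * (∑ i with a i = j, e i) ^ 2) := by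
    intro j
    have h1 := h.ridge_coordinate_error hn j
    rw [← hw] at h1
    rw [eq_div_of_mul_eq (hD j).ne' ((mul_comm _ _).trans h1), add_div]
    refine (add_sq_le).trans (le_of_eq ?_)
    generalize lam + w j * ζ j = D
    ring
  have hbias := h.sum_mul_inner_sq_le hρ' (fun j => by positivity) hs0 hs
  have h2 := Finset.sum_le_sum fun j (_ : j ∈ Finset.univ) => hcoord j
  rw [Finset.sum_add_distrib, ← Finset.mul_sum, ← Finset.mul_sum] at h2
  linarith [h.norm_sq_adjoint_sub_le hspan hρ']

/-- The variance of the noise terms is governed by the same rate as the bias, since the weights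
`w j` have sum at most `1`. -/
theorem IsOrderedEigensystem.sum_variance_le {T : L2 →L[ℝ] L2} {φ : ℕ → L2} {ζ : ℕ → ℝ}
    (h : IsOrderedEigensystem (T.adjoint ∘L T) φ ζ) {n J : ℕ} (hn : 0 < n) {N β : Fin J → ℝ}
    {lam : ℝ} (hlam : 0 < lam) {w : Fin J → ℝ} (hw : ∀ j, w j = N j * β j ^ 2 / n)
    (hw0 : ∀ j, 0 ≤ w j) (hw1 : ∑ j, w j ≤ 1) {s : ℝ} (hs0 : 0 ≤ s)
    (hs : ∀ j : Fin J, lam ^ 2 / (lam + w j * ζ j) ^ 2 * ζ j ≤ s) (v : ℝ) (hv : 0 ≤ v) :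
    ∑ j : Fin J, (ζ j * β j / n / (lam + w j * ζ j)) ^ 2 * (N j * v) ≤
      v / (n * lam ^ 2) * (‖T‖ ^ 2 * s) := by
  have hterm : ∀ j : Fin J, (ζ j * β j / n / (lam + w j * ζ j)) ^ 2 * (N j * v) ≤
      v / (n * lam ^ 2) * (‖T‖ ^ 2 * s) * w j := by
    intro j
    have hz := h.nonneg j
    have hD : 0 < lam + w j * ζ j := by have := hw0 j; positivity
    have e : (ζ j * β j / n / (lam + w j * ζ j)) ^ 2 * (N j * v) =
        v / (n * lam ^ 2) * (ζ j * (lam ^ 2 / (lam + w j * ζ j) ^ 2 * ζ j)) * w j := by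
      have hn' : (n : ℝ) ≠ 0 := by positivity
      have h1 : N j * β j ^ 2 = n * w j := by rw [hw]; field_simp
      have h2 : ∀ D : ℝ, (ζ j * β j / n / D) ^ 2 * (N j * v) =
          ζ j ^ 2 * v * (N j * β j ^ 2) / n ^ 2 / D ^ 2 := fun D => by ring
      rw [h2, h1]
      field_simp
    rw [e]
    have h1 := h.le_opNorm_sq j
    have h2 := hs j
    have h3 := hw0 j
    gcongr
  refine (Finset.sum_le_sum fun j _ => hterm j).trans ?_
  rw [← Finset.mul_sum]
  exact mul_le_of_le_one_right (by positivity) hw1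

/-- A random variable whose square is dominated by an integrable one is integrable, and
its mean satisfies Jensen's inequality. -/
theorem integrable_and_sq_integral_le {Ω : Type*} [MeasurableSpace Ω] {P : Measure Ω}
    [IsProbabilityMeasure P] {X G : Ω → ℝ} (hX : AEMeasurable X P) (hG : Integrable G P)
    (h : ∀ ω, X ω ^ 2 ≤ G ω) : Integrable X P ∧ (∫ ω, X ω ∂P) ^ 2 ≤ ∫ ω, G ω ∂P := by
  have hsq : Integrable (fun ω => X ω ^ 2) P :=
    hG.mono' (hX.pow_const 2).aestronglyMeasurable
      (Filter.Eventually.of_forall fun ω => by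
        rw [Real.norm_eq_abs, abs_of_nonneg (sq_nonneg _)]; exact h ω)
  have hL : MemLp X 2 P := (memLp_two_iff_integrable_sq hX.aestronglyMeasurable).2 hsq
  refine ⟨hL.integrable one_le_two, ?_⟩
  have h1 := variance_nonneg X P
  rw [variance_eq_sub hL] at h1
  have h2 : ∫ ω, (X ^ 2) ω ∂P ≤ ∫ ω, G ω ∂P := integral_mono hsq hG h
  linarith

/-- The policies of a passive query list are multiples of the top `J` directions, with squared
factors between `κ` and `1`. -/
theorem IsPassiveQueryList.exists_smul_direction {p : Spectrum} {C : Set (RKHSpace p)}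
    {φ : ℕ → L2} {κ : ℝ} {n J : ℕ} {Q : Fin n → RKHSpace p}
    (h : IsPassiveQueryList C φ κ n J Q) (hκ : 0 < κ) (hφ : ∀ j, ‖φ j‖ = 1)
    (hC : C ⊆ Metric.closedBall 0 1) :
    ∃ (β : Fin J → ℝ) (a : Fin n → Fin J),
      (∀ j, κ ≤ β j ^ 2 ∧ β j ^ 2 ≤ 1) ∧
      (∀ j, n / J ≤ (Finset.univ.filter fun i => a i = j).card) ∧
      ∀ i, Q i = β (a i) • direction p (φ (a i)) := by
  obtain ⟨π', a, hπ', hcount, hQ⟩ := h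
  have hd : ∀ j, direction p (φ j) ≠ 0 := fun j => by
    rw [← norm_ne_zero_iff, norm_direction, hφ]; exact one_ne_zero
  choose β hβ hβ' using fun j => (hπ' j).2.exists_eq_smul hκ (hd j)
  refine ⟨β, a, fun j => ⟨hβ j, ?_⟩, hcount, fun i => by rw [hQ, hβ']⟩
  have h1 := mem_closedBall_zero_iff.1 (hC (hπ' j).1)
  rw [hβ' j, norm_smul, norm_direction, hφ, mul_one, Real.norm_eq_abs] at h1
  exact sq_le_one_iff_abs_le_one _ |>.2 h1

end DoublyNonparametric

open DoublyNonparametric in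
theorem theorem2 (cpol B : ℝ) (hcpol : 0 < cpol) :
    ∃ c : ℝ, 0 < c ∧
      ∀ (p r : Spectrum) (M : RKHSpace p →L[ℝ] RKHSpace r),
        IsCompactOperator M → ‖tildeMap M‖ ≤ B →
      ∀ (φ : ℕ → L2) (ζ : ℕ → ℝ),
        IsOrderedEigensystem ((tildeMap M).adjoint ∘L tildeMap M) φ ζ →
      ∀ C : Set (RKHSpace p), C ⊆ Metric.closedBall 0 1 → IsRegular C φ cpol →
      ∀ rs : RKHSpace r, ‖rs‖ = 1 →
      ∀ πs : RKHSpace p, IsOptimalPolicy M C rs πs →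
      ∀ (n J : ℕ), 0 < J → J ≤ n →
      ∀ Q : Fin n → RKHSpace p, IsPassiveQueryList C φ cpol n J Q →
      ∀ (lam τ : ℝ), 0 < lam →
      ∀ {Ω : Type*} [MeasurableSpace Ω] (P : Measure Ω) [IsProbabilityMeasure P]
        (ε : Fin n → Ω → ℝ),
        iIndepFun ε P → (∀ i, HasLaw (ε i) (gaussianReal 0 (Real.toNNReal (τ ^ 2))) P) →
      ∀ πhat : Ω → RKHSpace p,
        (∀ ω, IsPlugin M C Q (fun i => oracle M rs (Q i) (ε i ω)) lam (πhat ω)) →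
        AEMeasurable (fun ω => excessRisk M rs πs (πhat ω)) P →
        Integrable (fun ω => excessRisk M rs πs (πhat ω)) P ∧
        (∫ ω, excessRisk M rs πs (πhat ω) ∂P) ^ 2 ≤
          c * (1 + τ ^ 2 / (n * lam ^ 2)) *
            max (⨆ j : Fin J, lam ^ 2 * (J : ℝ) ^ 2 * ζ j / (ζ j ^ 2 + lam ^ 2 * (J : ℝ) ^ 2))
              (⨆ j : {j : ℕ // J ≤ j}, ζ j) := by
  refine ⟨4 * (1 + 8 / cpol ^ 2 * (1 + B ^ 2)), by positivity, ?_⟩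
  intro p r M _ hB φ ζ hζ C hC _ rs hrs πs hπs n J hJ hJn Q hQ lam τ hlam Ω _ P _ ε hind hlaw
    πhat hplug hmeas
  set T := tildeMap M with hT
  obtain ⟨β, a, hβ, hcount, hQa⟩ := hQ.exists_smul_direction hcpol hζ.orthonormal.1 hC
  have hcpol1 : cpol ≤ 1 := (hβ ⟨0, hJ⟩).1.trans (hβ ⟨0, hJ⟩).2
  have hn : 0 < n := hJ.trans_le hJn
  have hn' : (0 : ℝ) < n := by exact_mod_cast hn
  have hJ' : (0 : ℝ) < J := by exact_mod_cast hJ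
  set N : Fin J → ℝ := fun j => (Finset.univ.filter fun i => a i = j).card with hN
  have hNsum : ∑ j, N j = n := by
    have h1 := Finset.card_eq_sum_card_fiberwise (f := a) (s := Finset.univ) (t := Finset.univ)
      (by simp)
    rw [Finset.card_univ, Fintype.card_fin] at h1
    simp only [hN]
    exact_mod_cast h1.symm
  have hNlow : ∀ j, (n : ℝ) / (2 * J) ≤ N j := by
    intro j
    -- `n < J (n / J + 1) ≤ 2 J (n / J)`, as `J ≤ n`
    have h1 : n < J * (n / J + 1) := Nat.lt_mul_div_succ n hJ
    have h2 : 1 ≤ n / J := (Nat.one_le_div_iff hJ).2 hJn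
    have h3 : n ≤ 2 * J * (Finset.univ.filter fun i => a i = j).card := by
      have := hcount j
      nlinarith
    rw [div_le_iff₀ (by positivity)]
    have h4 : (n : ℝ) ≤ 2 * J * N j := by simp only [hN]; exact_mod_cast h3
    linarith
  set w : Fin J → ℝ := fun j => N j * β j ^ 2 / n with hw
  have hw0 : ∀ j, 0 ≤ w j := fun j => by simp only [hw, hN]; positivity
  have hwlow : ∀ j, cpol / (2 * J) ≤ w j := by
    intro j
    calc cpol / (2 * J) = n / (2 * J) * cpol / n := by field_simp
      _ ≤ N j * β j ^ 2 / n := by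
        have := hNlow j
        have := (hβ j).1
        gcongr
  have hw1 : ∑ j, w j ≤ 1 := by
    have h1 : ∀ j, w j ≤ N j / n := fun j => by
      have h2 : 0 ≤ N j := by simp only [hN]; positivity
      simp only [hw]
      gcongr
      exact mul_le_of_le_one_right h2 (hβ j).2
    refine (Finset.sum_le_sum fun j _ => h1 j).trans ?_
    rw [← Finset.sum_div, hNsum, div_self hn'.ne']
  set S := ⨆ j : Fin J, lam ^ 2 * (J : ℝ) ^ 2 * ζ j / (ζ j ^ 2 + lam ^ 2 * (J : ℝ) ^ 2) with hS
  set U := ⨆ j : {j : ℕ // J ≤ j}, ζ j with hU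
  set m := max S U with hm
  have hζJ : ζ J ≤ m := by
    have hbdd : BddAbove (Set.range fun j : {j : ℕ // J ≤ j} => ζ j) :=
      ⟨ζ J, by rintro _ ⟨j, rfl⟩; exact hζ.antitone j.2⟩
    exact (le_ciSup hbdd ⟨J, le_rfl⟩).trans (le_max_right _ _)
  have hm0 : 0 ≤ m := (hζ.nonneg J).trans hζJ
  set s := 4 / cpol ^ 2 * m with hs
  have hs0 : 0 ≤ s := by positivity
  have hbias : ∀ j : Fin J, lam ^ 2 / (lam + w j * ζ j) ^ 2 * ζ j ≤ s := by
    intro j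
    refine (bias_factor_le hcpol hcpol1 hlam hJ' (hζ.nonneg j) (hwlow j)).trans ?_
    have h1 : lam ^ 2 * (J : ℝ) ^ 2 * ζ j / (ζ j ^ 2 + lam ^ 2 * (J : ℝ) ^ 2) ≤ m :=
      (le_ciSup (f := fun j : Fin J => lam ^ 2 * (J : ℝ) ^ 2 * ζ j /
        (ζ j ^ 2 + lam ^ 2 * (J : ℝ) ^ 2)) (Set.finite_range _).bddAbove j).trans
        (le_max_left _ _)
    exact mul_le_mul_of_nonneg_left h1 (by positivity)
  -- the pathwise bound of the squared excess risk by a quadratic polynomial in the noise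
  set G : Ω → ℝ := fun ω => 4 * (2 * s + 2 * ∑ j : Fin J, (ζ j * β j / n / (lam + w j * ζ j)) ^ 2 *
    (∑ i with a i = j, ε i ω) ^ 2 + ζ J) with hG
  have hpath : ∀ ω, excessRisk M rs πs (πhat ω) ^ 2 ≤ G ω := by
    intro ω
    obtain ⟨ρ, hρ, hopt⟩ := hplug ω
    have hnormal : ∀ x, lam * ⟪RKHSpace.sqrtS r ρ, x⟫_ℝ = 1 / (n : ℝ) * ∑ i,
        (β (a i) * ⟪RKHSpace.sqrtS r rs - RKHSpace.sqrtS r ρ, T (φ (a i))⟫_ℝ + ε i ω) *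
          (β (a i) * ⟪x, T (φ (a i))⟫_ℝ) := by
      intro x
      have h1 := hρ.normal_equation ((RKHSpace.sqrtS r).symm x)
      rw [← LinearIsometryEquiv.inner_map_map (RKHSpace.sqrtS r),
        LinearIsometryEquiv.apply_symm_apply] at h1
      rw [h1]
      congr 1
      refine Finset.sum_congr rfl fun i _ => ?_
      rw [oracle, hQa, reward_smul_direction, reward_smul_direction, reward_smul_direction,
        LinearIsometryEquiv.apply_symm_apply, inner_sub_left]
      ring
    have h1 := hζ.norm_sq_ridge_error_le hlam
      (by rw [LinearIsometryEquiv.norm_map, hrs]) hnormal (w := w) (fun j => rfl) hs0 hbias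
    have h2 := excessRisk_le M hC hπs.1 (ρ := rs) hopt
    have h3 : 0 ≤ excessRisk M rs πs (πhat ω) := sub_nonneg.2 (hπs.2 _ hopt.1)
    calc excessRisk M rs πs (πhat ω) ^ 2
        ≤ (2 * ‖T.adjoint (RKHSpace.sqrtS r ρ - RKHSpace.sqrtS r rs)‖) ^ 2 := by gcongr
      _ = 4 * ‖T.adjoint (RKHSpace.sqrtS r ρ - RKHSpace.sqrtS r rs)‖ ^ 2 := by ring
      _ ≤ G ω := mul_le_mul_of_nonneg_left h1 (by norm_num)
  have hmom := fun j : Fin J => integrable_and_integral_sq_sum_gaussian hind hlaw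
    (Finset.univ.filter fun i => a i = j)
  have hint : Integrable (fun ω => ∑ j : Fin J, (ζ j * β j / n / (lam + w j * ζ j)) ^ 2 *
      (∑ i with a i = j, ε i ω) ^ 2) P :=
    integrable_finsetSum _ fun j _ => (hmom j).1.const_mul _
  have hint' : Integrable (fun ω => 2 * s + 2 * ∑ j : Fin J,
      (ζ j * β j / n / (lam + w j * ζ j)) ^ 2 * (∑ i with a i = j, ε i ω) ^ 2) P :=
    (integrable_const _).add (hint.const_mul 2)
  have hGint : Integrable G P := (hint'.add (integrable_const (ζ J))).const_mul 4
  have hGval : ∫ ω, G ω ∂P = 4 * (2 * s + 2 * ∑ j : Fin J, (ζ j * β j / n / (lam + w j * ζ j)) ^ 2 *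
      (N j * τ ^ 2) + ζ J) := by
    rw [hG, integral_const_mul, integral_add hint' (integrable_const _), integral_add (integrable_const _) (hint.const_mul 2)]
    simp only [integral_const, probReal_univ, one_smul, integral_const_mul]
    rw [integral_finsetSum _ fun j _ => (hmom j).1.const_mul _]
    simp only [integral_const_mul, (hmom _).2, Real.coe_toNNReal _ (sq_nonneg τ), hN]
  obtain ⟨hI, hle⟩ := integrable_and_sq_integral_le hmeas hGint hpath
  refine ⟨hI, hle.trans ?_⟩
  have hvar := hζ.sum_variance_le hn hlam (w := w) (fun j => rfl) hw0 hw1 hs0 hbias (τ ^ 2)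
    (sq_nonneg τ)
  have hTB : ‖T‖ ^ 2 ≤ B ^ 2 := by gcongr
  set x := τ ^ 2 / (n * lam ^ 2) with hx
  have hx0 : 0 ≤ x := by positivity
  have hvar' : x * (‖T‖ ^ 2 * s) ≤ x * (B ^ 2 * s) := by gcongr
  rw [hGval]
  -- the last summand only completes the bound to a product
  calc _ ≤ 4 * (2 * s + 2 * (x * (B ^ 2 * s)) + m) := by linarith
    _ ≤ 4 * (2 * s + 2 * (x * (B ^ 2 * s)) + m) +
        4 * (x * m + 2 * s * x + 2 * B ^ 2 * s) := le_add_of_nonneg_right (by positivity)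
    _ = _ := by rw [hs]; ring
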